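/- A frequency is a strictly increasing sequence $\lambda=(\lambda_n)_{n\ge 1}$ of nonnegative real numbers tending to $+\infty$. Write $\mathbb C_\theta=\{s\in\mathbb C:\operatorname{Re}s>\theta\}$. Let $\mathcal D_\infty^{\mathrm{ext}}(\lambda)$ be the space of all $\lambda$-Dirichlet series $D=\sum_{n\ge1}a_ne^{-\lambda_ns}$ that converge at some point of $\mathbb C$ and whose sum admits a bounded holomorphic extension $f$ to $\mathbb C_0$, with norm $\|D\|=\sup_{s\in\mathbb C_0}|f(s)|$, and let $\mathcal D_\infty(\lambda)$ be its subspace of series converging on $\mathbb C_0$, with the same norm. Let $S_N:\mathcal D_\infty^{\mathrm{ext}}(\lambda)\to\mathcal D_\infty(\lambda)$, $\sum_{n\ge1}a_ne^{-\lambda_ns}\mapsto\sum_{n=1}^Na_ne^{-\lambda_ns}$, be the $N$-th partial sum operator and $\|S_N\|$ its operator norm. **Theorem.** Let $\lambda$ be a frequency. (1) There is $C>0$ such that, for all $M>N\ge1$, $$\|S_N\|\le C\left(1+\log\left(\frac{\lambda_M+\lambda_N}{\lambda_M-\lambda_N}\right)+(M-N-1)\right).$$ (2) For every real $K$ there is $C>0$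 such that, for all $M>N\ge1$ with $M\ge N+2$ or $\lambda_M\le K\lambda_N$, $$\|S_N\|\le C\left(\log\left(\frac{\lambda_M+\lambda_N}{\lambda_M-\lambda_N}\right)+(M-N-1)\right).$$ (3) Suppose that $\lambda$ satisfies (NC): for every $\delta>0$ there is $C>0$ such that for every $n\ge1$ there is $m>n$ with $$\log\left(\frac{\lambda_m+\lambda_n}{\lambda_m-\lambda_n}\right)+(m-n)\le Ce^{\delta\lambda_n}.$$ Then $\lambda$ satisfies Bohr's theorem: every $D\in\mathcal D_\infty^{\mathrm{ext}}(\lambda)$ converges uniformly on $\mathbb C_\varepsilon$, to its bounded holomorphic extension, for every $\varepsilon>0$. -/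

import Mathlib

open Filter Topology
open scoped ENNReal

noncomputable section

/-- A frequency: a (strictly) increasing sequence of nonnegative reals tending to `+∞`.
Indices start at `0`, so that `lam n` is the `(n+1)`-st term `λ_{n+1}` of `(λ_1, λ_2, …)`. -/
structure Frequency where
  seq : ℕ → ℝ
  strictMono : StrictMono seq
  nonneg : ∀ n, 0 ≤ seq n
  tendsto : Tendsto seq atTop atTop

instance : CoeFun Frequency (fun _ => ℕ → ℝ) := ⟨Frequency.seq⟩

/-- The open right half-plane `{Re s > θ}`. -/
def rightHalfPlane (θ : ℝ) : Set ℂ := {s | θ < s.re}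

namespace Frequency

variable (lam : Frequency)

/-- The sum of the first `N` terms, at the point `s`, of the Dirichlet series with
coefficients `a`. -/
def partialSum (a : ℕ → ℂ) (N : ℕ) (s : ℂ) : ℂ :=
  ∑ n ∈ Finset.range N, a n * Complex.exp (-(lam n : ℂ) * s)

/-- The Dirichlet series with coefficients `a` converges at `s` with sum `L`. -/
def HasSumAt (a : ℕ → ℂ) (s L : ℂ) : Prop :=
  Tendsto (fun N => lam.partialSum a N s) atTop (𝓝 L)

/-- The Dirichlet series with coefficients `a` converges at `s`. -/
def ConvergesAt (a : ℕ → ℂ) (s : ℂ) : Prop := ∃ L, lam.HasSumAt a s L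

/-- The Dirichlet series with coefficients `a` converges somewhere, and `f` is a bounded
holomorphic function on `{Re s > 0}` that extends its sum: to the right of some point of
convergence, `f` is the sum of the series. -/
structure IsBoundedExtension (a : ℕ → ℂ) (f : ℂ → ℂ) : Prop where
  differentiableOn : DifferentiableOn ℂ f (rightHalfPlane 0)
  bounded : ∃ B : ℝ, ∀ s ∈ rightHalfPlane 0, ‖f s‖ ≤ B
  eq_sum : ∃ s₀ : ℂ, lam.ConvergesAt a s₀ ∧
    ∀ s ∈ rightHalfPlane 0, s₀.re < s.re → ∀ L, lam.HasSumAt a s L → f s = L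

theorem norm_exp_sub_exp_le {w : ℂ} (hw : 0 < w.re) {x y : ℝ} (hxy : x ≤ y) :
    ‖Complex.exp (-(y : ℂ) * w) - Complex.exp (-(x : ℂ) * w)‖ ≤
      ‖w‖ / w.re * (Real.exp (-x * w.re) - Real.exp (-y * w.re)) := by
  have hf : ∀ t : ℝ, HasDerivAt
      (fun t : ℝ => Complex.exp (-(t : ℂ) * w) - Complex.exp (-(x : ℂ) * w))
      (Complex.exp (-(t : ℂ) * w) * (-1 * w)) t := fun t =>
    (((Complex.ofRealCLM.hasDerivAt (x := t)).neg.mul_const w).cexp.sub_const _)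
  have hB : ∀ t : ℝ, HasDerivAt
      (fun t : ℝ => ‖w‖ / w.re * (Real.exp (-x * w.re) - Real.exp (-t * w.re)))
      (‖w‖ / w.re * (-(Real.exp (-t * w.re) * (-1 * w.re)))) t := fun t =>
    ((((hasDerivAt_id t).neg.mul_const w.re).exp.const_sub _).const_mul _)
  refine image_norm_le_of_norm_deriv_right_le_deriv_boundary
    (a := x) (b := y) (fun t _ => (hf t).continuousAt.continuousWithinAt)
    (fun t _ => (hf t).hasDerivWithinAt) (by simp) hB ?_ ⟨hxy, le_rfl⟩
  intro t _
  rw [norm_mul, Complex.norm_exp]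
  apply le_of_eq
  have : (-(t : ℂ) * w).re = -t * w.re := by simp
  rw [this, norm_mul]
  field_simp
  simp

/-- A Dirichlet series that converges at `s₀` converges at every `s` with `Re s > Re s₀`. -/
theorem ConvergesAt.of_re_lt {a : ℕ → ℂ} {s₀ s : ℂ} (h : lam.ConvergesAt a s₀)
    (hs : s₀.re < s.re) : lam.ConvergesAt a s := by
  obtain ⟨L, hL⟩ := h
  set w := s - s₀ with hwdef
  have hw : 0 < w.re := by simp [hwdef, hs]
  set g : ℕ → ℂ := fun n => Complex.exp (-(lam n : ℂ) * w) with hg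
  set b : ℕ → ℂ := fun n => a n * Complex.exp (-(lam n : ℂ) * s₀) with hb
  have hterm : ∀ N, lam.partialSum a N s = ∑ n ∈ Finset.range N, g n • b n := by
    intro N
    refine Finset.sum_congr rfl fun n _ => ?_
    simp only [hg, hb, hwdef, smul_eq_mul]
    rw [mul_left_comm, ← Complex.exp_add]
    ring_nf
  have hL' : Tendsto (fun N => ∑ n ∈ Finset.range N, b n) atTop (𝓝 L) := hL
  obtain ⟨B, hB⟩ := hL'.norm.bddAbove_range
  have hBn : ∀ N, ‖∑ n ∈ Finset.range N, b n‖ ≤ B := fun N => hB ⟨N, rfl⟩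
  have hr0 : Tendsto (fun n => Real.exp (-lam n * w.re)) atTop (𝓝 0) := by
    refine Real.tendsto_exp_atBot.comp ?_
    exact (tendsto_neg_atTop_atBot.comp (lam.tendsto.atTop_mul_const hw)).congr
      fun n => by simp
  have hg0 : Tendsto g atTop (𝓝 0) := by
    rw [tendsto_zero_iff_norm_tendsto_zero]
    refine hr0.congr fun n => ?_
    simp [hg, Complex.norm_exp]
  have hsumr : Summable (fun n => Real.exp (-lam n * w.re) - Real.exp (-lam (n + 1) * w.re)) := by
    refine summable_of_sum_range_le (c := Real.exp (-lam 0 * w.re)) (fun n => ?_) (fun n => ?_)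
    · have := lam.strictMono (Nat.lt_succ_self n)
      rw [sub_nonneg]
      apply Real.exp_le_exp.2
      nlinarith
    · rw [Finset.sum_range_sub']
      linarith [Real.exp_pos (-lam n * w.re)]
  have hsum : Summable (fun n => (g (n + 1) - g n) • ∑ i ∈ Finset.range (n + 1), b i) := by
    refine Summable.of_norm_bounded ((hsumr.mul_left (‖w‖ / w.re)).mul_right B) fun n => ?_
    rw [norm_smul]
    have h1 := norm_exp_sub_exp_le hw (lam.strictMono (Nat.lt_succ_self n)).le
    exact mul_le_mul h1 (hBn _) (norm_nonneg _) ((norm_nonneg _).trans h1)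
  refine ⟨0 * L - ∑' n, (g (n + 1) - g n) • ∑ i ∈ Finset.range (n + 1), b i, ?_⟩
  unfold HasSumAt
  rw [← tendsto_add_atTop_iff_nat 1]
  have hlim := (hg0.mul ((tendsto_add_atTop_iff_nat 1).2 hL')).sub hsum.hasSum.tendsto_sum_nat
  refine hlim.congr fun N => ?_
  rw [hterm, Finset.sum_range_by_parts g b (N + 1)]
  simp only [Nat.add_sub_cancel, smul_eq_mul]

variable {lam} in
/-- Right of some abscissa the series converges to the extension. -/
theorem IsBoundedExtension.exists_hasSumAt {a : ℕ → ℂ} {f : ℂ → ℂ}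
    (h : lam.IsBoundedExtension a f) :
    ∃ θ : ℝ, 0 ≤ θ ∧ ∀ s : ℂ, θ < s.re → lam.HasSumAt a s (f s) := by
  obtain ⟨s₀, h₀, h₁⟩ := h.eq_sum
  refine ⟨max 0 s₀.re, le_max_left _ _, fun s hs => ?_⟩
  obtain ⟨L, hL⟩ := ConvergesAt.of_re_lt lam h₀ ((le_max_right _ _).trans_lt hs)
  rwa [h₁ s ((le_max_left _ _).trans_lt hs) ((le_max_right _ _).trans_lt hs) L hL]

theorem IsBoundedExtension.of_hasSumAt {a : ℕ → ℂ} {f : ℂ → ℂ}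
    (hd : DifferentiableOn ℂ f (rightHalfPlane 0))
    (hb : ∃ B : ℝ, ∀ s ∈ rightHalfPlane 0, ‖f s‖ ≤ B) (θ : ℝ)
    (h : ∀ s : ℂ, θ < s.re → lam.HasSumAt a s (f s)) : lam.IsBoundedExtension a f := by
  refine ⟨hd, hb, ((θ + 1 : ℝ) : ℂ), ⟨_, h _ (by simp)⟩, fun s _ hs L hL => ?_⟩
  refine tendsto_nhds_unique (h s ?_) hL
  simp only [Complex.ofReal_re] at hs
  linarith

variable {lam} in
/-- The bounded extension is unique on `{Re s > 0}`. -/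
theorem IsBoundedExtension.eqOn {a : ℕ → ℂ} {f g : ℂ → ℂ}
    (hf : lam.IsBoundedExtension a f) (hg : lam.IsBoundedExtension a g) :
    Set.EqOn f g (rightHalfPlane 0) := by
  obtain ⟨θ, hθ, h₁⟩ := hf.exists_hasSumAt
  obtain ⟨η, hη, h₂⟩ := hg.exists_hasSumAt
  have hopen : IsOpen (rightHalfPlane 0) := isOpen_lt continuous_const Complex.continuous_re
  have hconn : IsPreconnected (rightHalfPlane 0) :=
    (convex_halfSpace_re_gt (0 : ℝ)).isPreconnected
  have hmem : ((θ + η + 1 : ℝ) : ℂ) ∈ rightHalfPlane 0 := by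
    change (0 : ℝ) < θ + η + 1
    linarith
  refine (hf.differentiableOn.analyticOnNhd hopen).eqOn_of_preconnected_of_eventuallyEq
    (hg.differentiableOn.analyticOnNhd hopen) hconn
    (z₀ := ((θ + η + 1 : ℝ) : ℂ)) hmem ?_
  have : {s : ℂ | θ + η < s.re} ∈ 𝓝 ((θ + η + 1 : ℝ) : ℂ) :=
    (isOpen_lt continuous_const Complex.continuous_re).mem_nhds (by simp)
  filter_upwards [this] with s hs
  have hs : θ + η < s.re := hs
  exact tendsto_nhds_unique (h₁ s (by linarith)) (h₂ s (by linarith))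

theorem partialSum_add (a b : ℕ → ℂ) (N : ℕ) (s : ℂ) :
    lam.partialSum (a + b) N s = lam.partialSum a N s + lam.partialSum b N s := by
  simp [partialSum, add_mul, Finset.sum_add_distrib]

theorem partialSum_smul (c : ℂ) (a : ℕ → ℂ) (N : ℕ) (s : ℂ) :
    lam.partialSum (c • a) N s = c * lam.partialSum a N s := by
  simp [partialSum, mul_assoc, Finset.mul_sum]

/-- The space `D_∞^ext(λ)` of somewhere convergent Dirichlet series (given by their
coefficients) that have a bounded holomorphic extension to `{Re s > 0}`. -/
def DInfExt : Submodule ℂ (ℕ → ℂ) where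
  carrier := {a | ∃ f, lam.IsBoundedExtension a f}
  zero_mem' := ⟨0, IsBoundedExtension.of_hasSumAt lam (differentiableOn_const 0) ⟨0, by simp⟩ 0
    (fun s _ => by simp [HasSumAt, partialSum])⟩
  add_mem' := by
    rintro a b ⟨f, hf⟩ ⟨g, hg⟩
    obtain ⟨θ, hθ, h₁⟩ := hf.exists_hasSumAt
    obtain ⟨η, hη, h₂⟩ := hg.exists_hasSumAt
    obtain ⟨B, hB⟩ := hf.bounded
    obtain ⟨B', hB'⟩ := hg.bounded
    refine ⟨f + g, IsBoundedExtension.of_hasSumAt lam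
      (hf.differentiableOn.add hg.differentiableOn)
      ⟨B + B', fun s hs => (norm_add_le _ _).trans (add_le_add (hB s hs) (hB' s hs))⟩
      (θ + η) fun s hs => ?_⟩
    have hs₁ : θ < s.re := by linarith
    have hs₂ : η < s.re := by linarith
    exact (Tendsto.add (h₁ s hs₁) (h₂ s hs₂)).congr fun N => (lam.partialSum_add a b N s).symm
  smul_mem' := by
    rintro c a ⟨f, hf⟩
    obtain ⟨θ, hθ, h₁⟩ := hf.exists_hasSumAt
    obtain ⟨B, hB⟩ := hf.bounded
    refine ⟨fun s => c * f s, IsBoundedExtension.of_hasSumAt lam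
      (hf.differentiableOn.const_mul c)
      ⟨‖c‖ * B, fun s hs => ?_⟩ θ fun s hs => ?_⟩
    · rw [norm_mul]
      exact mul_le_mul_of_nonneg_left (hB s hs) (norm_nonneg c)
    · exact (Tendsto.const_mul c (h₁ s hs)).congr fun N => (lam.partialSum_smul c a N s).symm

/-- The space `D_∞(λ)` of those members of `D_∞^ext(λ)` that converge on `{Re s > 0}`. -/
def DInf : Submodule ℂ (ℕ → ℂ) where
  carrier := {a | a ∈ lam.DInfExt ∧ ∀ s ∈ rightHalfPlane 0, lam.ConvergesAt a s}
  zero_mem' := ⟨zero_mem _, fun s _ => ⟨0, by simp [HasSumAt, partialSum]⟩⟩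
  add_mem' := by
    rintro a b ⟨ha, ha'⟩ ⟨hb, hb'⟩
    refine ⟨add_mem ha hb, fun s hs => ?_⟩
    obtain ⟨L, hL⟩ := ha' s hs
    obtain ⟨L', hL'⟩ := hb' s hs
    exact ⟨L + L', (Tendsto.add hL hL').congr fun N => (lam.partialSum_add a b N s).symm⟩
  smul_mem' := by
    rintro c a ⟨ha, ha'⟩
    refine ⟨Submodule.smul_mem _ c ha, fun s hs => ?_⟩
    obtain ⟨L, hL⟩ := ha' s hs
    exact ⟨c * L, (Tendsto.const_mul c hL).congr fun N => (lam.partialSum_smul c a N s).symm⟩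

/-- The norm of `D_∞^ext(λ)` and of its subspace `D_∞(λ)`: the supremum over `{Re s > 0}` of
the modulus of the bounded extension. The infimum runs over the extensions `f`, which all
coincide on `{Re s > 0}` (see `supNorm_eq`). -/
def supNorm (a : ℕ → ℂ) : ℝ≥0∞ :=
  ⨅ (f : ℂ → ℂ) (_ : lam.IsBoundedExtension a f), ⨆ s ∈ rightHalfPlane 0, ‖f s‖ₑ

variable {lam} in
theorem supNorm_eq {a : ℕ → ℂ} {f : ℂ → ℂ} (hf : lam.IsBoundedExtension a f) :
    lam.supNorm a = ⨆ s ∈ rightHalfPlane 0, ‖f s‖ₑ := by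
  refine le_antisymm (iInf₂_le f hf) (le_iInf₂ fun g hg => ?_)
  refine iSup₂_mono fun s hs => ?_
  rw [hf.eqOn hg hs]

/-- Truncation of the coefficients to the first `N` of them. -/
def truncate (N : ℕ) (a : ℕ → ℂ) : ℕ → ℂ := fun n => if n < N then a n else 0

theorem hasSumAt_truncate (a : ℕ → ℂ) (N : ℕ) (s : ℂ) :
    lam.HasSumAt (truncate N a) s (lam.partialSum a N s) := by
  refine tendsto_const_nhds.congr' ?_
  filter_upwards [eventually_ge_atTop N] with K hK
  unfold partialSum
  rw [← Finset.sum_subset (Finset.range_mono hK)]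
  · refine Finset.sum_congr rfl fun n hn => ?_
    simp [truncate, Finset.mem_range.1 hn]
  · intro n _ hn
    simp [truncate, Finset.mem_range.not.1 hn]

theorem isBoundedExtension_truncate (a : ℕ → ℂ) (N : ℕ) :
    lam.IsBoundedExtension (truncate N a) (lam.partialSum a N) := by
  refine IsBoundedExtension.of_hasSumAt lam ?_
    ⟨∑ n ∈ Finset.range N, ‖a n‖, fun s hs => ?_⟩ 0 fun s _ => lam.hasSumAt_truncate a N s
  · unfold partialSum
    fun_prop
  · refine (norm_sum_le _ _).trans (Finset.sum_le_sum fun n _ => ?_)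
    rw [norm_mul, Complex.norm_exp]
    refine mul_le_of_le_one_right (norm_nonneg _) (Real.exp_le_one_iff.2 ?_)
    have h1 : 0 < s.re := hs
    have h2 := lam.nonneg n
    simp only [Complex.mul_re, Complex.neg_re, Complex.ofReal_re, Complex.neg_im,
      Complex.ofReal_im]
    nlinarith

theorem truncate_mem_DInf (a : ℕ → ℂ) (N : ℕ) : truncate N a ∈ lam.DInf :=
  ⟨⟨_, lam.isBoundedExtension_truncate a N⟩, fun s _ => ⟨_, lam.hasSumAt_truncate a N s⟩⟩

/-- The partial sum operator `S_N : D_∞^ext(λ) → D_∞(λ)`, which keeps the first `N` terms. -/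
def S (N : ℕ) : lam.DInfExt →ₗ[ℂ] lam.DInf where
  toFun a := ⟨truncate N a, lam.truncate_mem_DInf a N⟩
  map_add' a b := by
    ext n
    by_cases h : n < N <;> simp [truncate, h]
  map_smul' c a := by
    ext n
    by_cases h : n < N <;> simp [truncate, h]

/-- The operator norm (possibly `∞` a priori) of a linear map from `D_∞^ext(λ)` to `D_∞(λ)`. -/
def opNorm (T : lam.DInfExt →ₗ[ℂ] lam.DInf) : ℝ≥0∞ :=
  ⨆ (a : lam.DInfExt) (_ : lam.supNorm a ≤ 1), lam.supNorm (T a)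

/-- Condition (NC). -/
def NC : Prop :=
  ∀ δ : ℝ, 0 < δ → ∃ C : ℝ, 0 < C ∧ ∀ n : ℕ, ∃ m : ℕ, n < m ∧
    Real.log ((lam m + lam n) / (lam m - lam n)) + ((m : ℝ) - (n : ℝ)) ≤
      C * Real.exp (δ * lam n)

/-- `λ` satisfies Bohr's theorem: each member of `D_∞^ext(λ)` converges uniformly on
`{Re s > ε}`, to its extension, for all `ε > 0`. -/
def SatisfiesBohr : Prop :=
  ∀ (a : ℕ → ℂ) (f : ℂ → ℂ), lam.IsBoundedExtension a f → ∀ ε : ℝ, 0 < ε →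
    TendstoUniformlyOn (fun N => lam.partialSum a N) f atTop (rightHalfPlane ε)

end Frequency

end

/-! A partial sum is a sharp cut-off in frequency. The proof replaces it by a smooth one and pays
for the difference term by term. If `φ` is a Schwartz function with `φ (λ_k) = 0` for `k ≥ m`,
Fourier inversion gives `∑ φ(λ_k) a_k e^{-λ_k s} = ∫ 𝓕φ(t) f(s - 2πit) dt`. This holds far to the
right, where the series converges to `f`, and then on `Re s > 0` because both sides are holomorphic
(`IsBoundedExtension.sum_eq_integral`). Hence the smoothed sum is at most `‖𝓕φ‖₁ sup |f|`.

For a trapezoid `φ` of total width `L` with flanks of width `d`, `‖𝓕φ‖₁ ≤ C (1 + log (L/d))`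
(`exists_integral_norm_fourier_trapezoid_le`). The trapezoid with value `1` on `[-λ_n, λ_n]` and
flanks of width `λ_m - λ_n` has `L = 2λ_m`, which yields the logarithm in (1). The smoothed sum
exceeds the partial sum only by the `m - n - 1` terms with `n < k < m`. Each of them is bounded by a
constant times `sup |f|`, by a narrow trapezoid that isolates one frequency. For (2) the constant
`1` is absorbed into one of the other two summands.

For (3), (NC) turns this bound into growth `O(e^{δλ_n})` of the partial sums on `Re s > 0`. Abel
summation against `e^{-2δλ_n}` gives uniform convergence on `Re s > 2δ`, and the identity theorem
shows that the limit is `f`. -/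

open MeasureTheory FourierTransform SchwartzMap

/-! ### Smooth trapezoids -/

/-- The smooth trapezoid that vanishes off `(p, q + d)` and equals `1` on `[p + d, q]`. -/
noncomputable def trapezoid (p q d x : ℝ) : ℂ :=
  ((Real.smoothTransition ((x - p) / d) - Real.smoothTransition ((x - q) / d) : ℝ) : ℂ)

section trapezoid

variable {p q d : ℝ}

theorem trapezoid_eq_one (hd : 0 < d) {x : ℝ} (h₁ : p + d ≤ x) (h₂ : x ≤ q) :
    trapezoid p q d x = 1 := by
  rw [trapezoid, Real.smoothTransition.one_of_one_le, Real.smoothTransition.zero_of_nonpos]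
  · simp
  · exact div_nonpos_of_nonpos_of_nonneg (by linarith) hd.le
  · rw [le_div_iff₀ hd]; linarith

theorem trapezoid_eq_zero_of_le (hpq : p ≤ q) (hd : 0 < d) {x : ℝ} (h : x ≤ p) :
    trapezoid p q d x = 0 := by
  rw [trapezoid, Real.smoothTransition.zero_of_nonpos, Real.smoothTransition.zero_of_nonpos]
  · simp
  · exact div_nonpos_of_nonpos_of_nonneg (by linarith) hd.le
  · exact div_nonpos_of_nonpos_of_nonneg (by linarith) hd.le

theorem trapezoid_eq_zero_of_ge (hpq : p ≤ q) (hd : 0 < d) {x : ℝ} (h : q + d ≤ x) :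
    trapezoid p q d x = 0 := by
  rw [trapezoid, Real.smoothTransition.one_of_one_le, Real.smoothTransition.one_of_one_le]
  · simp
  · rw [le_div_iff₀ hd]; linarith
  · rw [le_div_iff₀ hd]; linarith

theorem norm_trapezoid_le_one (x : ℝ) : ‖trapezoid p q d x‖ ≤ 1 := by
  rw [trapezoid, Complex.norm_real, Real.norm_eq_abs, abs_le]
  have h₁ := Real.smoothTransition.nonneg ((x - p) / d)
  have h₂ := Real.smoothTransition.nonneg ((x - q) / d)
  have h₃ := Real.smoothTransition.le_one ((x - p) / d)
  have h₄ := Real.smoothTransition.le_one ((x - q) / d)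
  constructor <;> linarith

theorem contDiff_trapezoid {n : ℕ∞} : ContDiff ℝ n (trapezoid p q d) := by
  refine Complex.ofRealCLM.contDiff.comp (ContDiff.sub ?_ ?_) <;>
  exact Real.smoothTransition.contDiff.comp ((contDiff_id.sub contDiff_const).div_const _)

theorem support_trapezoid_subset (hpq : p ≤ q) (hd : 0 < d) :
    Function.support (trapezoid p q d) ⊆ Set.Icc p (q + d) := by
  intro x hx
  by_contra hx'
  refine hx ?_
  by_cases h : x ≤ p
  · exact trapezoid_eq_zero_of_le hpq hd h
  · refine trapezoid_eq_zero_of_ge hpq hd ?_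
    by_contra h'
    exact hx' ⟨by linarith, by linarith⟩

theorem hasCompactSupport_trapezoid (hpq : p ≤ q) (hd : 0 < d) :
    HasCompactSupport (trapezoid p q d) :=
  HasCompactSupport.intro isCompact_Icc fun x hx => by
    by_contra h
    exact hx (support_trapezoid_subset hpq hd h)

theorem integral_norm_trapezoid_le (hpq : p ≤ q) (hd : 0 < d) :
    ∫ x, ‖trapezoid p q d x‖ ≤ q - p + d := by
  have h : ∫ x in Set.Icc p (q + d), ‖trapezoid p q d x‖ = ∫ x, ‖trapezoid p q d x‖ :=
    setIntegral_eq_integral_of_forall_compl_eq_zero fun x hx => by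
      by_contra h
      exact hx (support_trapezoid_subset hpq hd (by simpa using h))
  rw [← h]
  have h2 : ∫ x in Set.Icc p (q + d), ‖trapezoid p q d x‖ ≤ ∫ x in Set.Icc p (q + d), (1 : ℝ) :=
    setIntegral_mono_on
      (contDiff_trapezoid (n := 0)).continuous.norm.continuousOn.integrableOn_Icc
      continuousOn_const.integrableOn_Icc measurableSet_Icc fun x _ => norm_trapezoid_le_one x
  refine h2.trans ?_
  simp only [integral_const, smul_eq_mul, mul_one, measureReal_restrict_apply_univ,
    Real.volume_real_Icc_of_le (show p ≤ q + d by linarith)]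
  linarith

end trapezoid

/-! ### The `L¹` norm of the Fourier transform of a trapezoid -/

theorem hasCompactSupport_deriv_smoothTransition :
    HasCompactSupport (deriv Real.smoothTransition) := by
  refine HasCompactSupport.intro (isCompact_Icc (a := (0 : ℝ)) (b := 1)) fun x hx => ?_
  by_cases h : x < 0
  · have : Real.smoothTransition =ᶠ[𝓝 x] fun _ => 0 := by
      filter_upwards [Iio_mem_nhds h] with y hy
      exact Real.smoothTransition.zero_of_nonpos (le_of_lt hy)
    rw [this.deriv_eq, deriv_const]
  · have h1 : 1 < x := by
      by_contra h'
      exact hx ⟨by linarith, by linarith⟩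
    have : Real.smoothTransition =ᶠ[𝓝 x] fun _ => 1 := by
      filter_upwards [Ioi_mem_nhds h1] with y hy
      exact Real.smoothTransition.one_of_one_le (le_of_lt hy)
    rw [this.deriv_eq, deriv_const]

theorem contDiff_deriv_smoothTransition {n : ℕ∞} :
    ContDiff ℝ n (deriv Real.smoothTransition) :=
  ((contDiff_infty_iff_deriv.1 (Real.smoothTransition.contDiff (n := ⊤))).2).of_le
    (by exact_mod_cast le_top)

/-- Each dilated copy of `g` contributes a factor `d`. With `c = 1/d` and `c = 1/d²` this bounds the
`L¹` norms of the first and second derivatives of a trapezoid by `O(1)` and `O(1/d)`, whatever its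
width. -/
theorem integral_norm_dilate_sub_le {g : ℝ → ℝ} (hg : Integrable g) {d : ℝ} (hd : 0 < d)
    (p q c : ℝ) :
    ∫ x, ‖(((g ((x - p) / d) - g ((x - q) / d)) * c : ℝ) : ℂ)‖ ≤ 2 * d * |c| * ∫ x, |g x| := by
  have hi : ∀ r, Integrable fun x => |g ((x - r) / d)| := fun r =>
    ((hg.norm.comp_div hd.ne').comp_sub_right r)
  have he : ∀ r, ∫ x, |g ((x - r) / d)| = d * ∫ x, |g x| := fun r => by
    rw [integral_sub_right_eq_self (fun x => |g (x / d)|) r,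
      Measure.integral_comp_div (fun x => |g x|) d, abs_of_pos hd, smul_eq_mul]
  calc ∫ x, ‖(((g ((x - p) / d) - g ((x - q) / d)) * c : ℝ) : ℂ)‖
      ≤ ∫ x, (|g ((x - p) / d)| + |g ((x - q) / d)|) * |c| := by
        refine integral_mono_of_nonneg (ae_of_all _ fun x => norm_nonneg _)
          (((hi p).add (hi q)).mul_const _) (ae_of_all _ fun x => ?_)
        simp only [Complex.norm_real, norm_mul, Real.norm_eq_abs]
        exact mul_le_mul_of_nonneg_right (abs_sub _ _) (abs_nonneg c)
    _ = 2 * d * |c| * ∫ x, |g x| := by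
        rw [integral_mul_const, integral_add (hi p) (hi q), he, he]
        ring

theorem hasDerivAt_dilate_sub {g : ℝ → ℝ} (hg : Differentiable ℝ g) {d : ℝ} (p q c x : ℝ) :
    HasDerivAt (fun x => (((g ((x - p) / d) - g ((x - q) / d)) * c : ℝ) : ℂ))
      (((deriv g ((x - p) / d) - deriv g ((x - q) / d)) * (c / d) : ℝ) : ℂ) x := by
  have h : ∀ r, HasDerivAt (fun x => g ((x - r) / d)) (deriv g ((x - r) / d) * (1 / d)) x :=
    fun r => (hg _).hasDerivAt.comp x (((hasDerivAt_id x).sub_const r).div_const d)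
  convert! (((h p).sub (h q)).mul_const c).ofReal_comp using 2
  ring

/-- The half-line is cut at `1/L` and `1/d`, and each piece uses one hypothesis: the bound `L`
contributes `1`, the bound `A/t` contributes `A log (L/d)`, and the bound `A/(d t²)` contributes
`A`. -/
theorem integral_Ioi_le_of_decay {g : ℝ → ℝ} (hg : Integrable g)
    {A d L : ℝ} (hd : 0 < d) (hdL : d ≤ L)
    (h₁ : ∀ t, 0 < t → g t ≤ L) (h₂ : ∀ t, 0 < t → g t * t ≤ A)
    (h₃ : ∀ t, 0 < t → g t * t ^ 2 ≤ A / d) :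
    ∫ t in Set.Ioi 0, g t ≤ 1 + A + A * Real.log (L / d) := by
  have hL : 0 < L := hd.trans_le hdL
  have hLd : L⁻¹ ≤ d⁻¹ := inv_anti₀ hd hdL
  have hL' : 0 < L⁻¹ := inv_pos.2 hL
  have hd' : 0 < d⁻¹ := inv_pos.2 hd
  have e1 : ∫ t in Set.Ioi 0, g t = (∫ t in (0 : ℝ)..L⁻¹, g t) + (∫ t in L⁻¹..d⁻¹, g t) +
      ∫ t in Set.Ioi d⁻¹, g t := by
    rw [intervalIntegral.integral_add_adjacent_intervals hg.intervalIntegrable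
      hg.intervalIntegrable, intervalIntegral.integral_interval_add_Ioi hg.integrableOn
      hg.integrableOn]
  have b1 : ∫ t in (0 : ℝ)..L⁻¹, g t ≤ 1 := by
    have : ∫ t in (0 : ℝ)..L⁻¹, g t ≤ ∫ t in (0 : ℝ)..L⁻¹, L :=
      intervalIntegral.integral_mono_on_of_le_Ioo hL'.le hg.intervalIntegrable (by simp)
        fun t ht => h₁ t ht.1
    refine this.trans ?_
    simp [hL.ne']
  have b2 : ∫ t in L⁻¹..d⁻¹, g t ≤ A * Real.log (L / d) := by
    have hint : IntervalIntegrable (fun t : ℝ => A * t⁻¹) volume L⁻¹ d⁻¹ :=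
      (intervalIntegrable_inv_iff.2 (Or.inr (Set.notMem_uIcc_of_lt hL' hd'))).const_mul A
    have : ∫ t in L⁻¹..d⁻¹, g t ≤ ∫ t in L⁻¹..d⁻¹, A * t⁻¹ :=
      intervalIntegral.integral_mono_on hLd hg.intervalIntegrable hint fun t ht => by
        have ht0 : 0 < t := hL'.trans_le ht.1
        rw [← div_eq_mul_inv, le_div_iff₀ ht0]
        exact h₂ t ht0
    refine this.trans (le_of_eq ?_)
    rw [intervalIntegral.integral_const_mul, integral_inv_of_pos hL' hd']
    congr 2
    field_simp
  have b3 : ∫ t in Set.Ioi d⁻¹, g t ≤ A := by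
    have hlt : (-2 : ℝ) < -1 := by norm_num
    have : ∫ t in Set.Ioi d⁻¹, g t ≤ ∫ t in Set.Ioi d⁻¹, A / d * t ^ (-2 : ℝ) :=
      setIntegral_mono_on hg.integrableOn ((integrableOn_Ioi_rpow_of_lt hlt hd').const_mul _)
        measurableSet_Ioi fun t ht => by
        have ht0 : 0 < t := hd'.trans ht
        rw [Real.rpow_neg ht0.le, ← div_eq_mul_inv, le_div_iff₀ (by positivity)]
        exact_mod_cast h₃ t ht0
    refine this.trans (le_of_eq ?_)
    rw [integral_const_mul, integral_Ioi_rpow_of_lt hlt hd']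
    have : (-2 : ℝ) + 1 = -1 := by norm_num
    rw [this, Real.rpow_neg_one]
    field_simp
  rw [e1]
  linarith

theorem integral_le_of_decay {g : ℝ → ℝ} (hg : Integrable g)
    {A d L : ℝ} (hd : 0 < d) (hdL : d ≤ L)
    (h₁ : ∀ t, g t ≤ L) (h₂ : ∀ t, g t * |t| ≤ A) (h₃ : ∀ t, g t * t ^ 2 ≤ A / d) :
    ∫ t, g t ≤ 2 * (1 + A + A * Real.log (L / d)) := by
  have e : ∫ t, g t = (∫ t in Set.Ioi 0, g (-t)) + ∫ t in Set.Ioi 0, g t := by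
    rw [integral_comp_neg_Ioi, neg_zero, intervalIntegral.integral_Iic_add_Ioi hg.integrableOn
      hg.integrableOn]
  have a := integral_Ioi_le_of_decay hg hd hdL (fun t _ => h₁ t)
    (fun t ht => by simpa [abs_of_pos ht] using h₂ t) (fun t _ => h₃ t)
  have b := integral_Ioi_le_of_decay hg.comp_neg hd hdL (fun t _ => h₁ (-t))
    (fun t ht => by simpa [abs_of_pos ht] using h₂ (-t)) (fun t _ => by simpa using h₃ (-t))
  rw [e]
  linarith

/-- The `L¹` norm of the Fourier transform of a trapezoid grows at most logarithmically in the
ratio of its width to the width of its flanks. -/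
theorem exists_integral_norm_fourier_trapezoid_le :
    ∃ C : ℝ, 0 < C ∧ ∀ p q d : ℝ, p ≤ q → 0 < d → ∃ φ : 𝓢(ℝ, ℂ),
      (∀ x, φ x = trapezoid p q d x) ∧
      ∫ t, ‖𝓕 φ t‖ ≤ C * (1 + Real.log ((q - p + d) / d)) := by
  set ψ := deriv Real.smoothTransition with hψ
  have hψc : ContDiff ℝ 1 ψ := by exact_mod_cast contDiff_deriv_smoothTransition (n := 1)
  have hψi : Integrable ψ :=
    hψc.continuous.integrable_of_hasCompactSupport hasCompactSupport_deriv_smoothTransition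
  have hψi' : Integrable (deriv ψ) :=
    (hψc.continuous_deriv le_rfl).integrable_of_hasCompactSupport
      hasCompactSupport_deriv_smoothTransition.deriv
  set A := 2 * (∫ x, |ψ x|) + 2 * ∫ x, |deriv ψ x| with hAdef
  have hA1 : 0 ≤ ∫ x, |ψ x| := integral_nonneg fun x => abs_nonneg _
  have hA2 : 0 ≤ ∫ x, |deriv ψ x| := integral_nonneg fun x => abs_nonneg _
  have hA : 0 ≤ A := by positivity
  refine ⟨2 * (1 + A), by positivity, fun p q d hpq hd => ?_⟩
  set φ : 𝓢(ℝ, ℂ) := (hasCompactSupport_trapezoid hpq hd).toSchwartzMap contDiff_trapezoid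
    with hφdef
  have hφ : ∀ x, φ x = trapezoid p q d x := fun x => rfl
  refine ⟨φ, hφ, ?_⟩
  set φ₁ := derivCLM ℂ ℂ φ with hφ₁
  set φ₂ := derivCLM ℂ ℂ φ₁ with hφ₂
  have e1 : ∀ x, φ₁ x = (((ψ ((x - p) / d) - ψ ((x - q) / d)) * (1 / d) : ℝ) : ℂ) := fun x => by
    have := hasDerivAt_dilate_sub (Real.smoothTransition.contDiff.differentiable
      (n := 1) (by simp)) (d := d) p q 1 x
    rw [hφ₁, derivCLM_apply, ← this.deriv]
    congr 1
    ext x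
    simp [hφ, trapezoid]
  have e2 : ∀ x, φ₂ x =
      (((deriv ψ ((x - p) / d) - deriv ψ ((x - q) / d)) * (1 / d / d) : ℝ) : ℂ) := fun x => by
    have := hasDerivAt_dilate_sub (hψc.differentiable (by simp)) (d := d) p q (1 / d) x
    rw [hφ₂, derivCLM_apply, ← this.deriv]
    congr 1
    ext x
    exact e1 x
  have hle : ∀ (g : 𝓢(ℝ, ℂ)) (t : ℝ), ‖𝓕 g t‖ ≤ ∫ x, ‖g x‖ := fun g t => by
    rw [← norm_toLp_one]
    exact norm_fourier_apply_le_toLp_one g t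
  -- Differentiation multiplies the transform by `2πit`; the factor `2π ≥ 1` is discarded.
  have hder : ∀ (g : 𝓢(ℝ, ℂ)) (t : ℝ), ‖𝓕 g t‖ * |t| ≤ ‖𝓕 (derivCLM ℂ ℂ g) t‖ := fun g t => by
    have : 𝓕 (derivCLM ℂ ℂ g) t = (2 * Real.pi * Complex.I * t) • 𝓕 g t := by
      have := congrFun (Real.fourier_deriv g.integrable g.differentiable
        (derivCLM ℂ ℂ g).integrable) t
      exact this
    rw [this, norm_smul]
    simp only [norm_mul, Complex.norm_ofNat, Complex.norm_real, Complex.norm_I, mul_one,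
      Real.norm_eq_abs, abs_of_pos Real.pi_pos]
    rw [mul_comm]
    refine mul_le_mul_of_nonneg_right ?_ (norm_nonneg _)
    nlinarith [abs_nonneg t, Real.pi_gt_three]
  have b0 : ∀ t, ‖𝓕 φ t‖ ≤ q - p + d := fun t =>
    (hle φ t).trans (integral_norm_trapezoid_le hpq hd)
  have b1 : ∀ t, ‖𝓕 φ₁ t‖ ≤ 2 * ∫ x, |ψ x| := fun t => by
    refine (hle φ₁ t).trans ?_
    simp only [e1]
    refine (integral_norm_dilate_sub_le hψi hd p q (1 / d)).trans (le_of_eq ?_)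
    rw [abs_of_pos (by positivity)]
    field_simp
  have b2 : ∀ t, ‖𝓕 φ₂ t‖ ≤ 2 * (∫ x, |deriv ψ x|) / d := fun t => by
    refine (hle φ₂ t).trans ?_
    simp only [e2]
    refine (integral_norm_dilate_sub_le hψi' hd p q (1 / d / d)).trans (le_of_eq ?_)
    rw [abs_of_pos (by positivity)]
    field_simp
  have hlog : 0 ≤ Real.log ((q - p + d) / d) :=
    Real.log_nonneg (by rw [le_div_iff₀ hd]; linarith)
  have key := integral_le_of_decay (g := fun t => ‖𝓕 φ t‖) (𝓕 φ).integrable.norm hd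
    (A := A) (L := q - p + d) (by linarith) b0
    (fun t => ((hder φ t).trans (b1 t)).trans (by linarith))
    (fun t => by
      have h1 : ‖𝓕 φ t‖ * t ^ 2 = (‖𝓕 φ t‖ * |t|) * |t| := by
        rw [mul_assoc, abs_mul_abs_self, sq]
      rw [h1]
      refine (mul_le_mul_of_nonneg_right (hder φ t) (abs_nonneg t)).trans
        (((hder φ₁ t).trans (b2 t)).trans ?_)
      exact div_le_div_of_nonneg_right (by linarith) hd.le)
  refine key.trans ?_
  nlinarith

/-! ### Identity theorem on half-planes and Abel summation -/

namespace Frequency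

theorem isOpen_rightHalfPlane (θ : ℝ) : IsOpen (rightHalfPlane θ) :=
  isOpen_lt continuous_const Complex.continuous_re

theorem isPreconnected_rightHalfPlane (θ : ℝ) : IsPreconnected (rightHalfPlane θ) :=
  (convex_halfSpace_re_gt θ).isPreconnected

/-- Holomorphic functions on a half-plane that agree far to the right agree everywhere. -/
theorem eqOn_rightHalfPlane {f g : ℂ → ℂ} {η θ : ℝ}
    (hf : DifferentiableOn ℂ f (rightHalfPlane η)) (hg : DifferentiableOn ℂ g (rightHalfPlane η))
    (h : ∀ s : ℂ, θ < s.re → f s = g s) : Set.EqOn f g (rightHalfPlane η) := by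
  have hmem : ((max η θ + 1 : ℝ) : ℂ) ∈ rightHalfPlane η := by
    change η < (((max η θ + 1 : ℝ) : ℂ)).re
    rw [Complex.ofReal_re]
    linarith [le_max_left η θ]
  refine (hf.analyticOnNhd (isOpen_rightHalfPlane η)).eqOn_of_preconnected_of_eventuallyEq
    (hg.analyticOnNhd (isOpen_rightHalfPlane η)) (isPreconnected_rightHalfPlane η) hmem ?_
  have : rightHalfPlane θ ∈ 𝓝 ((max η θ + 1 : ℝ) : ℂ) := by
    refine (isOpen_rightHalfPlane θ).mem_nhds ?_
    change θ < (((max η θ + 1 : ℝ) : ℂ)).re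
    rw [Complex.ofReal_re]
    linarith [le_max_right η θ]
  filter_upwards [this] with s hs
  exact h s hs

variable (lam : Frequency)

/-- Summation by parts: the boundary term costs at most `B`, and the total variation of `n ↦ e^{-λ_n
w}` is at most `‖w‖ / Re w`, since the bounds of `norm_exp_sub_exp_le` telescope. -/
theorem norm_sum_exp_mul_le {b : ℕ → ℂ} {B : ℝ}
    (hB : ∀ N, ‖∑ n ∈ Finset.range N, b n‖ ≤ B) {w : ℂ} (hw : 0 < w.re) (N : ℕ) :
    ‖∑ n ∈ Finset.range N, Complex.exp (-(lam n : ℂ) * w) * b n‖ ≤ B * (1 + ‖w‖ / w.re) := by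
  have hB0 : 0 ≤ B := (norm_nonneg _).trans (hB 0)
  have hexp : ∀ n, Real.exp (-lam n * w.re) ≤ 1 := fun n =>
    Real.exp_le_one_iff.2 (by nlinarith [lam.nonneg n])
  have h₁ : ‖Complex.exp (-(lam (N - 1) : ℂ) * w)‖ ≤ 1 := by
    rw [Complex.norm_exp]
    simpa using hexp (N - 1)
  have h₂ : ‖∑ n ∈ Finset.range (N - 1),
      (Complex.exp (-(lam (n + 1) : ℂ) * w) - Complex.exp (-(lam n : ℂ) * w)) •
        ∑ i ∈ Finset.range (n + 1), b i‖ ≤ B * (‖w‖ / w.re) := by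
    calc _ ≤ ∑ n ∈ Finset.range (N - 1), ‖w‖ / w.re *
          (Real.exp (-lam n * w.re) - Real.exp (-lam (n + 1) * w.re)) * B := by
          refine norm_sum_le_of_le _ fun n _ => ?_
          rw [norm_smul]
          have := norm_exp_sub_exp_le hw (lam.strictMono (Nat.lt_succ_self n)).le
          exact mul_le_mul this (hB _) (norm_nonneg _) ((norm_nonneg _).trans this)
      _ = B * (‖w‖ / w.re) *
          (Real.exp (-lam 0 * w.re) - Real.exp (-lam (N - 1) * w.re)) := by
          rw [← Finset.sum_mul, ← Finset.mul_sum,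
            Finset.sum_range_sub' (fun n => Real.exp (-lam n * w.re))]
          ring
      _ ≤ B * (‖w‖ / w.re) * 1 := by
          refine mul_le_mul_of_nonneg_left ?_ (by positivity)
          linarith [hexp 0, Real.exp_pos (-lam (N - 1) * w.re)]
      _ = _ := mul_one _
  have key := Finset.sum_range_by_parts (fun n => Complex.exp (-(lam n : ℂ) * w)) b N
  simp only [smul_eq_mul] at key h₂
  rw [key]
  refine (norm_sub_le _ _).trans ?_
  rw [mul_add, mul_one]
  refine add_le_add ?_ h₂
  rw [norm_mul]
  calc _ ≤ 1 * B := mul_le_mul h₁ (hB N) (norm_nonneg _) zero_le_one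
    _ = B := one_mul B

theorem partialSum_eq_sum_exp_mul (a : ℕ → ℂ) (N : ℕ) (s s₀ : ℂ) :
    lam.partialSum a N s = ∑ n ∈ Finset.range N,
      Complex.exp (-(lam n : ℂ) * (s - s₀)) * (a n * Complex.exp (-(lam n : ℂ) * s₀)) := by
  refine Finset.sum_congr rfl fun n _ => ?_
  rw [mul_left_comm, ← Complex.exp_add]
  ring_nf

variable {lam}

/-- On a vertical line the bound grows only linearly in `Im s`, uniformly in `N`. Integration
against a Schwartz function can therefore be dominated. -/
theorem ConvergesAt.exists_norm_partialSum_le {a : ℕ → ℂ} {s₀ : ℂ} (h : lam.ConvergesAt a s₀) :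
    ∃ B : ℝ, 0 ≤ B ∧ ∀ s : ℂ, s₀.re < s.re → ∀ N,
      ‖lam.partialSum a N s‖ ≤ B * (1 + ‖s - s₀‖ / (s.re - s₀.re)) := by
  obtain ⟨L, hL⟩ := h
  obtain ⟨B, hB⟩ := hL.norm.bddAbove_range
  refine ⟨B, (norm_nonneg _).trans (hB ⟨0, rfl⟩), fun s hs N => ?_⟩
  rw [partialSum_eq_sum_exp_mul lam a N s s₀, ← Complex.sub_re]
  exact norm_sum_exp_mul_le lam (fun N => hB ⟨N, rfl⟩) (by simpa using hs) N

/-! ### Smoothed sums as vertical convolutions of the extension -/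

/-- The vertical shift by `-2πit` multiplies `e^{-xs}` by the character `e^{2πitx}`, so Fourier
inversion at `x` applies. -/
theorem integral_fourier_mul_exp (φ : 𝓢(ℝ, ℂ)) (x : ℝ) (s : ℂ) :
    ∫ t, 𝓕 φ t * Complex.exp (-(x : ℂ) * (s - 2 * Real.pi * t * Complex.I)) =
      φ x * Complex.exp (-(x : ℂ) * s) := by
  have h : φ x = 𝓕⁻ (𝓕 φ : 𝓢(ℝ, ℂ)) x := by rw [FourierTransform.fourierInv_fourier_eq]
  rw [h, fourierInv_coe, Real.fourierInv_eq', ← integral_mul_const]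
  congr 1
  ext t
  have : Complex.exp (-(x : ℂ) * (s - 2 * Real.pi * t * Complex.I)) =
      Complex.exp (((2 * Real.pi * inner ℝ t x : ℝ) : ℂ) * Complex.I) *
        Complex.exp (-(x : ℂ) * s) := by
    rw [← Complex.exp_add]
    congr 1
    simp
    ring
  rw [this, smul_eq_mul]
  ring

theorem integrable_fourier_mul_exp (φ : 𝓢(ℝ, ℂ)) (x : ℝ) (s : ℂ) :
    Integrable fun t : ℝ =>
      𝓕 φ t * Complex.exp (-(x : ℂ) * (s - 2 * Real.pi * t * Complex.I)) := by
  refine (𝓕 φ).integrable.mul_bdd (c := Real.exp (-x * s.re)) (by fun_prop)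
    (ae_of_all _ fun t => ?_)
  rw [Complex.norm_exp]
  simp

/-- For each partial sum the identity is linear in the terms. Passing to `f` under the integral is
dominated convergence, and on the other side the sums are constant from `N = m` on. -/
theorem IsBoundedExtension.exists_sum_eq_integral {a : ℕ → ℂ} {f : ℂ → ℂ}
    (hf : lam.IsBoundedExtension a f) (φ : 𝓢(ℝ, ℂ)) {m : ℕ} (hφ : ∀ k, m ≤ k → φ (lam k) = 0) :
    ∃ θ : ℝ, ∀ s : ℂ, θ < s.re →
      ∑ k ∈ Finset.range m, φ (lam k) * (a k * Complex.exp (-(lam k : ℂ) * s)) =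
        ∫ t : ℝ, 𝓕 φ t * f (s - 2 * Real.pi * t * Complex.I) := by
  obtain ⟨θ₁, -, h₁⟩ := hf.exists_hasSumAt
  obtain ⟨s₀, hs₀, -⟩ := hf.eq_sum
  obtain ⟨B, hB0, hB⟩ := hs₀.exists_norm_partialSum_le
  refine ⟨max θ₁ s₀.re, fun s hs => ?_⟩
  have hs1 : θ₁ < s.re := (le_max_left _ _).trans_lt hs
  have hs2 : s₀.re < s.re := (le_max_right _ _).trans_lt hs
  have hre : ∀ t : ℝ, (s - 2 * Real.pi * t * Complex.I).re = s.re := fun t => by simp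
  have hint : ∀ N, ∫ t : ℝ, 𝓕 φ t * lam.partialSum a N (s - 2 * Real.pi * t * Complex.I) =
      ∑ k ∈ Finset.range N, φ (lam k) * (a k * Complex.exp (-(lam k : ℂ) * s)) := fun N => by
    simp only [partialSum, Finset.mul_sum]
    rw [integral_finsetSum]
    · refine Finset.sum_congr rfl fun k _ => ?_
      simp only [mul_left_comm _ (a k)]
      rw [integral_const_mul, integral_fourier_mul_exp]
    · intro k _
      simp only [mul_left_comm _ (a k)]
      exact (integrable_fourier_mul_exp φ _ s).const_mul _
  have hlim : Tendsto (fun N => ∫ t : ℝ, 𝓕 φ t *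
      lam.partialSum a N (s - 2 * Real.pi * t * Complex.I)) atTop
      (𝓝 (∫ t : ℝ, 𝓕 φ t * f (s - 2 * Real.pi * t * Complex.I))) := by
    set c := s.re - s₀.re with hc
    have hc0 : 0 < c := sub_pos.2 hs2
    refine tendsto_integral_of_dominated_convergence
      (fun t => B * (1 + ‖s - s₀‖ / c) * ‖𝓕 φ t‖ +
        B * (2 * Real.pi) / c * (‖t‖ ^ 1 * ‖𝓕 φ t‖)) (fun N => ?_) ?_ (fun N => ?_) ?_
    · refine Continuous.aestronglyMeasurable ?_
      unfold partialSum
      fun_prop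
    · exact ((𝓕 φ).integrable.norm.const_mul _).add (((𝓕 φ).integrable_pow_mul volume 1).const_mul _)
    · refine ae_of_all _ fun t => ?_
      rw [norm_mul]
      have h2 := hB (s - 2 * Real.pi * t * Complex.I) (by rwa [hre]) N
      rw [hre, ← hc] at h2
      have h3 : ‖s - 2 * Real.pi * t * Complex.I - s₀‖ ≤ ‖s - s₀‖ + 2 * Real.pi * ‖t‖ := by
        have : s - 2 * Real.pi * t * Complex.I - s₀ =
          (s - s₀) - 2 * Real.pi * t * Complex.I := by ring
        rw [this]
        refine (norm_sub_le _ _).trans (le_of_eq ?_)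
        simp [abs_of_pos Real.pi_pos]
      have h4 : ‖lam.partialSum a N (s - 2 * Real.pi * t * Complex.I)‖ ≤
          B * (1 + (‖s - s₀‖ + 2 * Real.pi * ‖t‖) / c) := by
        refine h2.trans ?_
        gcongr
      refine (mul_le_mul_of_nonneg_left h4 (norm_nonneg _)).trans (le_of_eq ?_)
      field_simp
      ring
    · refine ae_of_all _ fun t => ?_
      exact (h₁ _ (by rwa [hre])).const_mul _
  refine tendsto_nhds_unique (tendsto_const_nhds.congr' ?_) hlim
  filter_upwards [eventually_ge_atTop m] with N hN
  rw [hint]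
  refine Finset.sum_subset (Finset.range_mono hN) fun k _ hk => ?_
  rw [hφ k (by simpa using hk), zero_mul]

theorem differentiableOn_integral_mul_comp_sub {f : ℂ → ℂ} {B : ℝ}
    (hd : DifferentiableOn ℂ f (rightHalfPlane 0)) (hB : ∀ s ∈ rightHalfPlane 0, ‖f s‖ ≤ B)
    (k : 𝓢(ℝ, ℂ)) :
    DifferentiableOn ℂ (fun s => ∫ t : ℝ, k t * f (s - 2 * Real.pi * t * Complex.I))
      (rightHalfPlane 0) := by
  intro s hs
  have hs0 : 0 < s.re := hs
  have hre : ∀ (z : ℂ) (t : ℝ), (z - 2 * Real.pi * t * Complex.I).re = z.re := fun z t => by simp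
  have hmem : ∀ (z : ℂ) (t : ℝ), 0 < z.re →
      z - 2 * Real.pi * t * Complex.I ∈ rightHalfPlane 0 := fun z t hz => by
    change 0 < (z - 2 * Real.pi * t * Complex.I).re
    rwa [hre]
  have hopen := isOpen_rightHalfPlane 0
  have hcont : ∀ {g : ℂ → ℂ}, ContinuousOn g (rightHalfPlane 0) → ∀ z : ℂ, 0 < z.re →
      AEStronglyMeasurable (fun t : ℝ => k t * g (z - 2 * Real.pi * t * Complex.I)) volume :=
    fun {g} hg z hz => by
      refine (k.continuous.mul ?_).aestronglyMeasurable
      exact hg.comp_continuous (by fun_prop) fun t => hmem z t hz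
  have hU : rightHalfPlane (s.re / 2) ∈ 𝓝 s :=
    (isOpen_rightHalfPlane _).mem_nhds (show s.re / 2 < s.re by linarith)
  have hpos : ∀ z ∈ rightHalfPlane (s.re / 2), 0 < z.re := fun z hz => by
    have : s.re / 2 < z.re := hz
    linarith
  -- Cauchy's estimate on discs of radius `Re s / 2`, which stay in `Re > 0`, bounds `f'` uniformly
  -- in `t` and justifies differentiation under the integral.
  have hderiv : ∀ z ∈ rightHalfPlane (s.re / 2), ∀ t : ℝ,
      ‖deriv f (z - 2 * Real.pi * t * Complex.I)‖ ≤ B / (s.re / 2) := fun z hz t => by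
    have hz' : s.re / 2 < z.re := hz
    have hsub : Metric.closedBall (z - 2 * Real.pi * t * Complex.I) (s.re / 2) ⊆
        rightHalfPlane 0 := fun w hw => by
      have h1 : ‖w - (z - 2 * Real.pi * t * Complex.I)‖ ≤ s.re / 2 := by
        simpa [dist_eq_norm] using hw
      have h2 := (Complex.abs_re_le_norm _).trans h1
      rw [Complex.sub_re, hre] at h2
      change 0 < w.re
      linarith [(abs_le.1 h2).1]
    refine Complex.norm_deriv_le_of_forall_mem_sphere_norm_le (by linarith)
      (hd.diffContOnCl_ball hsub) fun w hw => hB w (hsub (Metric.sphere_subset_closedBall hw))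
  refine DifferentiableAt.differentiableWithinAt (HasDerivAt.differentiableAt
    (hasDerivAt_integral_of_dominated_loc_of_deriv_le
    (F' := fun z t => k t * deriv f (z - 2 * Real.pi * t * Complex.I))
    (bound := fun t => ‖k t‖ * (B / (s.re / 2))) hU ?_ ?_ ?_ ?_ ?_ ?_).2)
  · filter_upwards [hU] with z hz
    exact hcont hd.continuousOn z (hpos z hz)
  · refine Integrable.mono' (k.integrable.norm.mul_const B) (hcont hd.continuousOn s hs0)
      (ae_of_all _ fun t => ?_)
    rw [norm_mul]
    exact mul_le_mul_of_nonneg_left (hB _ (hmem s t hs0)) (norm_nonneg _)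
  · exact hcont (hd.deriv hopen).continuousOn s hs0
  · refine ae_of_all _ fun t z hz => ?_
    rw [norm_mul]
    exact mul_le_mul_of_nonneg_left (hderiv z hz t) (norm_nonneg _)
  · exact k.integrable.norm.mul_const _
  · refine ae_of_all _ fun t z hz => ?_
    have h := (hd.differentiableAt (hopen.mem_nhds (hmem z t (hpos z hz)))).hasDerivAt
    exact (h.comp_sub_const z _).const_mul _

theorem IsBoundedExtension.sum_eq_integral {a : ℕ → ℂ} {f : ℂ → ℂ}
    (hf : lam.IsBoundedExtension a f) (φ : 𝓢(ℝ, ℂ)) {m : ℕ} (hφ : ∀ k, m ≤ k → φ (lam k) = 0)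
    {s : ℂ} (hs : s ∈ rightHalfPlane 0) :
    ∑ k ∈ Finset.range m, φ (lam k) * (a k * Complex.exp (-(lam k : ℂ) * s)) =
      ∫ t : ℝ, 𝓕 φ t * f (s - 2 * Real.pi * t * Complex.I) := by
  obtain ⟨θ, hθ⟩ := hf.exists_sum_eq_integral φ hφ
  obtain ⟨B, hB⟩ := hf.bounded
  exact eqOn_rightHalfPlane (f := fun s => ∑ k ∈ Finset.range m, φ (lam k) *
    (a k * Complex.exp (-(lam k : ℂ) * s))) (by fun_prop)
    (differentiableOn_integral_mul_comp_sub hf.differentiableOn hB (𝓕 φ)) hθ hs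

theorem IsBoundedExtension.norm_sum_le {a : ℕ → ℂ} {f : ℂ → ℂ}
    (hf : lam.IsBoundedExtension a f) {B : ℝ} (hB : ∀ s ∈ rightHalfPlane 0, ‖f s‖ ≤ B)
    (φ : 𝓢(ℝ, ℂ)) {m : ℕ} (hφ : ∀ k, m ≤ k → φ (lam k) = 0)
    {s : ℂ} (hs : s ∈ rightHalfPlane 0) :
    ‖∑ k ∈ Finset.range m, φ (lam k) * (a k * Complex.exp (-(lam k : ℂ) * s))‖ ≤
      (∫ t, ‖𝓕 φ t‖) * B := by
  rw [hf.sum_eq_integral φ hφ hs, ← integral_mul_const]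
  refine norm_integral_le_of_norm_le ((𝓕 φ).integrable.norm.mul_const B) (ae_of_all _ fun t => ?_)
  rw [norm_mul]
  refine mul_le_mul_of_nonneg_left (hB _ ?_) (norm_nonneg _)
  have h : 0 < s.re := hs
  change 0 < (s - 2 * Real.pi * t * Complex.I).re
  simpa using h

/-! ### Bounds of partial sums and of `‖S_N‖` -/

theorem exists_gap_left (lam : Frequency) (n : ℕ) :
    ∃ d : ℝ, 0 < d ∧ ∀ k < n, lam k + d ≤ lam n := by
  cases n with
  | zero => exact ⟨1, one_pos, fun k hk => absurd hk (Nat.not_lt_zero k)⟩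
  | succ j =>
    refine ⟨lam (j + 1) - lam j, sub_pos.2 (lam.strictMono (Nat.lt_succ_self j)), fun k hk => ?_⟩
    have := lam.strictMono.monotone (Nat.le_of_lt_succ hk)
    linarith

theorem log_ratio_nonneg (lam : Frequency) {n m : ℕ} (h : n < m) :
    0 ≤ Real.log ((lam m + lam n) / (lam m - lam n)) := by
  have h₁ := sub_pos.2 (lam.strictMono h)
  refine Real.log_nonneg ?_
  rw [le_div_iff₀ h₁]
  linarith [lam.nonneg n]

/-- A bound of the partial sums of a Dirichlet series by a bound of its extension. -/
theorem exists_norm_partialSum_le : ∃ C : ℝ, 0 < C ∧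
    ∀ (lam : Frequency) (a : ℕ → ℂ) (f : ℂ → ℂ), lam.IsBoundedExtension a f →
      ∀ B : ℝ, (∀ s ∈ rightHalfPlane 0, ‖f s‖ ≤ B) → ∀ s ∈ rightHalfPlane 0, ∀ n m : ℕ, n < m →
        ‖lam.partialSum a (n + 1) s‖ ≤
          C * (1 + Real.log ((lam m + lam n) / (lam m - lam n)) + ((m : ℝ) - (n : ℝ) - 1)) * B := by
  obtain ⟨C, hC, key⟩ := exists_integral_norm_fourier_trapezoid_le
  refine ⟨2 * C, by positivity, fun lam a f hf B hB s hs n m hnm => ?_⟩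
  have hB0 : 0 ≤ B := (norm_nonneg _).trans (hB s hs)
  have hlog2 : Real.log 2 ≤ 1 := by linarith [Real.log_two_lt_d9]
  -- A trapezoid with peak at `λ_n` and flanks shorter than or equal to both neighbouring gaps
  -- isolates one term. Its width is `2d`, so the ratio in the logarithm is `2` whatever the gaps
  -- are.
  have hterm : ∀ n, ‖a n * Complex.exp (-(lam n : ℂ) * s)‖ ≤ 2 * C * B := fun n => by
    obtain ⟨e, he, hle⟩ := lam.exists_gap_left n
    have hgap := sub_pos.2 (lam.strictMono (Nat.lt_succ_self n))
    set d := min e (lam (n + 1) - lam n) with hd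
    have hd0 : 0 < d := lt_min he hgap
    obtain ⟨φ, hφ, hint⟩ := key (lam n - d) (lam n) d (by linarith) hd0
    have h0 : ∀ k, n + 1 ≤ k → φ (lam k) = 0 := fun k hk => by
      rw [hφ]
      refine trapezoid_eq_zero_of_ge (by linarith) hd0 ?_
      have := lam.strictMono.monotone hk
      linarith [min_le_right e (lam (n + 1) - lam n)]
    have hsum := hf.norm_sum_le hB φ h0 hs
    rw [Finset.sum_range_succ, Finset.sum_eq_zero, zero_add, hφ,
      trapezoid_eq_one hd0 (by linarith) le_rfl, one_mul] at hsum
    · refine hsum.trans (mul_le_mul_of_nonneg_right (hint.trans ?_) hB0)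
      have : (lam n - (lam n - d) + d) / d = 2 := by field_simp; ring
      rw [this]
      nlinarith
    · intro k hk
      rw [hφ, trapezoid_eq_zero_of_le (by linarith) hd0, zero_mul]
      linarith [hle k (Finset.mem_range.1 hk), min_le_left e (lam (n + 1) - lam n)]
  have hd0 := sub_pos.2 (lam.strictMono hnm)
  have hn := lam.nonneg n
  -- This trapezoid is `1` on `[-λ_n, λ_n]`, hence at `λ_0, …, λ_n`, and vanishes from `λ_m` on.
  -- Starting at `-λ_m` lets the left flank be as wide as the right one without touching any
  -- frequency.
  obtain ⟨φ, hφ, hint⟩ := key (-lam m) (lam n) (lam m - lam n) (by linarith) hd0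
  have hsum := hf.norm_sum_le hB φ (m := m) (fun k hk => by
    rw [hφ]
    refine trapezoid_eq_zero_of_ge (by linarith) hd0 ?_
    linarith [lam.strictMono.monotone hk]) hs
  have hsplit := Finset.sum_range_add_sum_Ico
    (fun k => φ (lam k) * (a k * Complex.exp (-(lam k : ℂ) * s))) (Nat.succ_le_of_lt hnm)
  have hone : ∑ k ∈ Finset.range (n + 1), φ (lam k) * (a k * Complex.exp (-(lam k : ℂ) * s)) =
      lam.partialSum a (n + 1) s := by
    refine Finset.sum_congr rfl fun k hk => ?_
    rw [hφ, trapezoid_eq_one hd0, one_mul]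
    · linarith [lam.nonneg k]
    · exact lam.strictMono.monotone (Nat.le_of_lt_succ (Finset.mem_range.1 hk))
  have htail : ‖∑ k ∈ Finset.Ico (n + 1) m,
      φ (lam k) * (a k * Complex.exp (-(lam k : ℂ) * s))‖ ≤
        ((m : ℝ) - (n : ℝ) - 1) * (2 * C * B) := by
    refine (norm_sum_le_of_le _ (n := fun _ => 2 * C * B) fun k _ => ?_).trans (le_of_eq ?_)
    · rw [norm_mul, hφ]
      exact (mul_le_of_le_one_left (norm_nonneg _) (norm_trapezoid_le_one _)).trans (hterm k)
    · rw [Finset.sum_const, Nat.card_Ico, nsmul_eq_mul, Nat.cast_sub hnm]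
      push_cast
      ring
  -- The total width is `2λ_m ≤ 2(λ_m + λ_n)`, and `log 2 ≤ 1`.
  have hlog : Real.log ((lam n - -lam m + (lam m - lam n)) / (lam m - lam n)) ≤
      1 + Real.log ((lam m + lam n) / (lam m - lam n)) := by
    have hpos : 0 < (lam m + lam n) / (lam m - lam n) := div_pos (by linarith) hd0
    calc _ ≤ Real.log (2 * ((lam m + lam n) / (lam m - lam n))) := by
          refine Real.log_le_log (div_pos (by linarith) hd0) ?_
          rw [← mul_div_assoc]
          exact div_le_div_of_nonneg_right (by linarith) hd0.le
      _ = Real.log 2 + Real.log ((lam m + lam n) / (lam m - lam n)) :=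
          Real.log_mul two_ne_zero hpos.ne'
      _ ≤ _ := by linarith
  have hfirst : (∫ t, ‖𝓕 φ t‖) * B ≤
      2 * C * (1 + Real.log ((lam m + lam n) / (lam m - lam n))) * B := by
    refine mul_le_mul_of_nonneg_right (hint.trans ?_) hB0
    nlinarith [lam.log_ratio_nonneg hnm]
  rw [hone] at hsplit
  rw [eq_sub_of_add_eq hsplit]
  refine (norm_sub_le _ _).trans ((add_le_add (hsum.trans hfirst) htail).trans (le_of_eq ?_))
  ring

theorem exists_opNorm_S_le : ∃ C : ℝ, 0 < C ∧ ∀ (lam : Frequency) (n m : ℕ), n < m →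
    lam.opNorm (lam.S (n + 1)) ≤ ENNReal.ofReal
      (C * (1 + Real.log ((lam m + lam n) / (lam m - lam n)) + ((m : ℝ) - (n : ℝ) - 1))) := by
  obtain ⟨C, hC, key⟩ := exists_norm_partialSum_le
  refine ⟨C, hC, fun lam n m hnm => iSup₂_le fun a ha => ?_⟩
  obtain ⟨f, hf⟩ := a.2
  have hB : ∀ s ∈ rightHalfPlane 0, ‖f s‖ ≤ 1 := fun s hs => by
    rw [supNorm_eq hf] at ha
    have h : ‖f s‖ₑ ≤ 1 := (le_iSup₂ (f := fun s (_ : s ∈ rightHalfPlane 0) => ‖f s‖ₑ) s hs).trans ha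
    rw [← ofReal_norm] at h
    exact ENNReal.ofReal_le_one.1 h
  change lam.supNorm (truncate (n + 1) a) ≤ _
  rw [supNorm_eq (lam.isBoundedExtension_truncate a (n + 1))]
  refine iSup₂_le fun s hs => ?_
  rw [← ofReal_norm]
  refine ENNReal.ofReal_le_ofReal ?_
  simpa using key lam a f hf 1 hB s hs n m hnm

/-- For fixed `λ_n` the ratio decreases in `λ_m`, so `λ_m ≤ K' λ_n` keeps it at least `(K' + 1)/(K'
- 1) > 1`. Taking `K' = max K 2` keeps this lower bound meaningful for every real `K`. -/
theorem exists_one_le_mul_log_ratio (lam : Frequency) (K : ℝ) : ∃ A : ℝ, 0 < A ∧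
    ∀ n m : ℕ, n < m → lam m ≤ K * lam n →
      1 ≤ A * Real.log ((lam m + lam n) / (lam m - lam n)) := by
  set K' := max K 2 with hK'
  have h2 : 2 ≤ K' := le_max_right _ _
  have hl : 0 < Real.log ((K' + 1) / (K' - 1)) := by
    refine Real.log_pos ?_
    rw [lt_div_iff₀ (by linarith)]
    linarith
  refine ⟨(Real.log ((K' + 1) / (K' - 1)))⁻¹, inv_pos.2 hl, fun n m hnm hm => ?_⟩
  rw [← div_eq_inv_mul, le_div_iff₀ hl, one_mul]
  have hd := sub_pos.2 (lam.strictMono hnm)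
  have hn := lam.nonneg n
  have hm' : lam m ≤ K' * lam n := hm.trans (mul_le_mul_of_nonneg_right (le_max_left _ _) hn)
  refine Real.log_le_log (div_pos (by linarith) (by linarith)) ?_
  rw [div_le_div_iff₀ (by linarith) hd]
  linarith

theorem exists_opNorm_S_le_of_le (lam : Frequency) (K : ℝ) : ∃ C : ℝ, 0 < C ∧
    ∀ n m : ℕ, n < m → (n + 2 ≤ m ∨ lam m ≤ K * lam n) →
      lam.opNorm (lam.S (n + 1)) ≤ ENNReal.ofReal
        (C * (Real.log ((lam m + lam n) / (lam m - lam n)) + ((m : ℝ) - (n : ℝ) - 1))) := by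
  obtain ⟨C, hC, key⟩ := exists_opNorm_S_le
  obtain ⟨A, hA, hlog⟩ := lam.exists_one_le_mul_log_ratio K
  -- The summand `1` of the general bound is at most `m - n - 1` if `m ≥ n + 2`, and at most `A`
  -- times the logarithm if `λ_m ≤ K λ_n`.
  refine ⟨C * (2 + A), by positivity, fun n m hnm h => (key lam n m hnm).trans
    (ENNReal.ofReal_le_ofReal ?_)⟩
  rw [mul_assoc]
  refine mul_le_mul_of_nonneg_left ?_ hC.le
  have h0 := lam.log_ratio_nonneg hnm
  have h1 : (n : ℝ) + 1 ≤ m := by exact_mod_cast hnm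
  rcases h with h | h
  · have h2 : (n : ℝ) + 2 ≤ m := by exact_mod_cast h
    nlinarith
  · have := hlog n m hnm h
    nlinarith

/-! ### From growth of partial sums to Bohr's theorem -/

/-- Abel summation writes the sums at `s` through those at `s - ε`, which trades distance from the
boundary for the decaying weights `e^{-λ_n ε}`. -/
theorem partialSum_succ_eq (lam : Frequency) (a : ℕ → ℂ) (N : ℕ) (s : ℂ) (ε : ℝ) :
    lam.partialSum a (N + 1) s =
      Complex.exp (-(lam N : ℂ) * ε) * lam.partialSum a (N + 1) (s - ε) -
        ∑ n ∈ Finset.range N,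
          (Complex.exp (-(lam (n + 1) : ℂ) * ε) - Complex.exp (-(lam n : ℂ) * ε)) *
            lam.partialSum a (n + 1) (s - ε) := by
  rw [partialSum_eq_sum_exp_mul lam a (N + 1) s (s - ε), sub_sub_cancel]
  have h := Finset.sum_range_by_parts (fun n => Complex.exp (-(lam n : ℂ) * ε))
    (fun n => a n * Complex.exp (-(lam n : ℂ) * (s - ε))) (N + 1)
  simpa only [partialSum, smul_eq_mul, Nat.add_sub_cancel] using h

theorem tendsto_exp_neg_mul (lam : Frequency) {δ : ℝ} (hδ : 0 < δ) :
    Tendsto (fun n => Real.exp (-lam n * δ)) atTop (𝓝 0) := by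
  refine Real.tendsto_exp_atBot.comp ?_
  exact (tendsto_neg_atTop_atBot.comp (lam.tendsto.atTop_mul_const hδ)).congr fun n => by simp

theorem summable_exp_sub_exp (lam : Frequency) {δ : ℝ} (hδ : 0 < δ) :
    Summable fun n => Real.exp (-lam n * δ) - Real.exp (-lam (n + 1) * δ) := by
  refine summable_of_sum_range_le (c := Real.exp (-lam 0 * δ)) (fun n => ?_) (fun n => ?_)
  · have := lam.strictMono (Nat.lt_succ_self n)
    rw [sub_nonneg]
    apply Real.exp_le_exp.2
    nlinarith
  · rw [Finset.sum_range_sub' (fun n => Real.exp (-lam n * δ))]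
    linarith [Real.exp_pos (-lam n * δ)]

/-- Partial sums of subexponential growth in `λ_N` on a half-plane converge uniformly on smaller
half-planes. -/
theorem exists_tendstoUniformlyOn_partialSum (lam : Frequency) {a : ℕ → ℂ} {C δ : ℝ} (hδ : 0 < δ)
    (h : ∀ s ∈ rightHalfPlane 0, ∀ n, ‖lam.partialSum a (n + 1) s‖ ≤ C * Real.exp (δ * lam n)) :
    ∃ g : ℂ → ℂ, TendstoUniformlyOn (fun N => lam.partialSum a N) g atTop
      (rightHalfPlane (2 * δ)) := by
  -- The shift is twice the growth exponent: one factor `e^{-δλ_n}` cancels the growth, and the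
  -- other makes the boundary term vanish and the series of differences telescope.
  set ε : ℝ := 2 * δ with hε
  have hmem : ∀ s ∈ rightHalfPlane ε, s - (ε : ℂ) ∈ rightHalfPlane 0 := fun s hs => by
    have hs' : ε < s.re := hs
    change 0 < (s - (ε : ℂ)).re
    simpa using hs'
  have hcexp : ∀ n, Complex.exp (-(lam n : ℂ) * ε) = (Real.exp (-lam n * ε) : ℝ) := fun n => by
    push_cast
    rfl
  have hC : 0 ≤ C := by
    have := (norm_nonneg _).trans (h 1 (by simp [rightHalfPlane]) 0)
    exact nonneg_of_mul_nonneg_left this (Real.exp_pos _)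
  have hexp2 : ∀ n, Real.exp (-lam n * ε) = Real.exp (-lam n * δ) * Real.exp (-lam n * δ) :=
    fun n => by rw [← Real.exp_add, hε]; ring_nf
  have hinv : ∀ n, Real.exp (δ * lam n) * Real.exp (-lam n * δ) = 1 := fun n => by
    rw [← Real.exp_add]
    ring_nf
    exact Real.exp_zero
  have hboundary : TendstoUniformlyOn (fun N s => Complex.exp (-(lam N : ℂ) * ε) *
      lam.partialSum a (N + 1) (s - ε)) (fun _ => 0) atTop (rightHalfPlane ε) := by
    rw [Metric.tendstoUniformlyOn_iff]
    intro r hr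
    have ht : Tendsto (fun N => C * Real.exp (-lam N * δ)) atTop (𝓝 0) := by
      simpa using (lam.tendsto_exp_neg_mul hδ).const_mul C
    filter_upwards [ht.eventually_lt_const hr] with N hN s hs
    rw [dist_zero_left, norm_mul, hcexp, Complex.norm_real, Real.norm_eq_abs, Real.abs_exp]
    refine lt_of_le_of_lt ?_ hN
    refine (mul_le_mul_of_nonneg_left (h _ (hmem s hs) N) (Real.exp_pos _).le).trans (le_of_eq ?_)
    rw [hexp2]
    linear_combination C * Real.exp (-lam N * δ) * hinv N
  have hsum := tendstoUniformlyOn_tsum_nat (s := rightHalfPlane ε)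
    (f := fun n s => (Complex.exp (-(lam (n + 1) : ℂ) * ε) - Complex.exp (-(lam n : ℂ) * ε)) *
      lam.partialSum a (n + 1) (s - ε))
    ((lam.summable_exp_sub_exp hδ).mul_left (2 * C)) fun n s hs => by
      have hle : Real.exp (-lam (n + 1) * δ) ≤ Real.exp (-lam n * δ) :=
        Real.exp_le_exp.2 (by nlinarith [lam.strictMono (Nat.lt_succ_self n)])
      have hle' : Real.exp (-lam (n + 1) * ε) ≤ Real.exp (-lam n * ε) := by
        rw [hexp2, hexp2]
        exact mul_le_mul hle hle (Real.exp_pos _).le (Real.exp_pos _).le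
      rw [norm_mul, hcexp, hcexp, ← Complex.ofReal_sub, Complex.norm_real, Real.norm_eq_abs,
        abs_sub_comm, abs_of_nonneg (sub_nonneg.2 hle')]
      refine (mul_le_mul_of_nonneg_left (h _ (hmem s hs) n) (sub_nonneg.2 hle')).trans ?_
      rw [hexp2, hexp2]
      set x := Real.exp (-lam n * δ)
      set y := Real.exp (-lam (n + 1) * δ)
      set z := Real.exp (δ * lam n)
      have hz : 0 < z := Real.exp_pos _
      have hzx : z * x = 1 := hinv n
      have hzy : z * y ≤ 1 := hzx ▸ mul_le_mul_of_nonneg_left hle hz.le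
      -- Factoring the difference of squares leaves the summable `x - y`, while `z (x + y) ≤ 2`
      -- absorbs the growth.
      calc (x * x - y * y) * (C * z) = C * (x - y) * (z * x + z * y) := by ring
        _ ≤ C * (x - y) * 2 :=
          mul_le_mul_of_nonneg_left (by linarith) (mul_nonneg hC (sub_nonneg.2 hle))
        _ = 2 * C * (x - y) := by ring
  refine ⟨fun s => 0 - ∑' n, (Complex.exp (-(lam (n + 1) : ℂ) * ε) -
    Complex.exp (-(lam n : ℂ) * ε)) * lam.partialSum a (n + 1) (s - ε), ?_⟩
  have hshift := hboundary.sub hsum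
  rw [Metric.tendstoUniformlyOn_iff] at hshift ⊢
  intro r hr
  obtain ⟨N₀, hN₀⟩ := eventually_atTop.1 (hshift r hr)
  filter_upwards [eventually_ge_atTop (N₀ + 1)] with N hN s hs
  obtain ⟨M, rfl⟩ : ∃ M, N = M + 1 := ⟨N - 1, by omega⟩
  rw [lam.partialSum_succ_eq a M s ε]
  exact hN₀ M (by omega) s hs

theorem IsBoundedExtension.tendstoUniformlyOn {a : ℕ → ℂ} {f g : ℂ → ℂ}
    (hf : lam.IsBoundedExtension a f) {ε : ℝ} (hε : 0 ≤ ε)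
    (h : TendstoUniformlyOn (fun N => lam.partialSum a N) g atTop (rightHalfPlane ε)) :
    TendstoUniformlyOn (fun N => lam.partialSum a N) f atTop (rightHalfPlane ε) := by
  obtain ⟨θ, hθ, hsum⟩ := hf.exists_hasSumAt
  have hg : DifferentiableOn ℂ g (rightHalfPlane ε) :=
    h.tendstoLocallyUniformlyOn.differentiableOn
      (Eventually.of_forall fun N => by unfold partialSum; fun_prop) (isOpen_rightHalfPlane ε)
  have hsub : rightHalfPlane ε ⊆ rightHalfPlane 0 := fun s hs => hε.trans_lt hs
  refine h.congr_right (eqOn_rightHalfPlane hg (hf.differentiableOn.mono hsub)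
    (θ := max θ ε) fun s hs => ?_)
  exact tendsto_nhds_unique (h.tendsto_at ((le_max_right _ _).trans_lt hs))
    (hsum s ((le_max_left _ _).trans_lt hs))

theorem NC.satisfiesBohr (hNC : lam.NC) : lam.SatisfiesBohr := by
  intro a f hf ε hε
  obtain ⟨C, hC, key⟩ := exists_norm_partialSum_le
  -- Growth exponent `ε / 2` gives convergence on `Re s > ε`. The `1` and the `m - n - 1` of the
  -- general bound add up to the `m - n` of (NC).
  obtain ⟨C', hC', hm⟩ := hNC (ε / 2) (half_pos hε)
  obtain ⟨B, hB⟩ := hf.bounded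
  have hB0 : 0 ≤ B := (norm_nonneg _).trans (hB 1 (by simp [rightHalfPlane]))
  obtain ⟨g, hg⟩ := lam.exists_tendstoUniformlyOn_partialSum (a := a) (C := C * C' * B)
    (half_pos hε) fun s hs n => by
      obtain ⟨m, hnm, hle⟩ := hm n
      refine (key lam a f hf B hB s hs n m hnm).trans ?_
      calc _ ≤ C * (C' * Real.exp (ε / 2 * lam n)) * B :=
            mul_le_mul_of_nonneg_right (mul_le_mul_of_nonneg_left (by linarith) hC.le) hB0
        _ = _ := by ring
  rw [mul_div_cancel₀ ε two_ne_zero] at hg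
  exact hf.tendstoUniformlyOn hε.le hg

end Frequency

theorem mainTheorem2 (lam : Frequency) :
    (∃ C : ℝ, 0 < C ∧ ∀ n m : ℕ, n < m →
      lam.opNorm (lam.S (n + 1)) ≤ ENNReal.ofReal
        (C * (1 + Real.log ((lam m + lam n) / (lam m - lam n)) + ((m : ℝ) - (n : ℝ) - 1)))) ∧
    (∀ K : ℝ, ∃ C : ℝ, 0 < C ∧ ∀ n m : ℕ, n < m → (n + 2 ≤ m ∨ lam m ≤ K * lam n) →
      lam.opNorm (lam.S (n + 1)) ≤ ENNReal.ofReal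
        (C * (Real.log ((lam m + lam n) / (lam m - lam n)) + ((m : ℝ) - (n : ℝ) - 1)))) ∧
    (lam.NC → lam.SatisfiesBohr) := by
  obtain ⟨C, hC, h⟩ := Frequency.exists_opNorm_S_le
  exact ⟨⟨C, hC, h lam⟩, lam.exists_opNorm_S_le_of_le, Frequency.NC.satisfiesBohr⟩
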